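/- **Setting.** Let $V_S$ (supply nodes) and $V_D$ (demand nodes) be finite sets, let $E\subseteq V_S\times V_D$ be a compatibility graph, with neighbourhoods $\partial(j')=\{i:(i,j')\in E\}$ and $\partial(i)=\{j':(i,j')\in E\}$, and let $\phi=(\phi_{j'k})_{j'\in V_D,k\in V_S}$ be nonnegative arrival rates with $\sum_{j',k}\phi_{j'k}=1$ and $\sum_k\phi_{j'k}>0$ for every $j'\in V_D$. Assume non-triviality: there are $j'\in V_D$ and $k\in V_S\setminus\partial(j')$ with $\phi_{j'k}>0$. For $K\ge 1$ the state space is $\Omega_K=\{x\in\mathbb N^{V_S}:\sum_i x_i=K\}$. A stationary policy $U=(U^K)_K$ assigns to every $x\in\Omega_K$, $j'\in V_D$, $k\in V_S$ a value $U^K[x](j',k)\in\{i\in\partial(j'):x_i>0\}\cup\{\emptyset\}$. Let $(o[t],d[t])_{t\ge1}$ be i.i.d. with law $\phi$. From $X[0]\in\Omega_K$ the state evolves as follows: with $S[t]=U^K[X[t-1]](o[t],d[t])$, $X[t]=X[t-1]-e_{S[t]}+e_{d[t]}$ if $S[t]\ne\emptyset$, and $X[t]=X[t-1]$ (the demand is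 dropped) if $S[t]=\emptyset$. Put $$\mathbb P_{\mathrm o}^{K,U}=\min_{X[0]\in\Omega_K}\mathbb E\Big(\lim_{T\to\infty}\frac1T\sum_{t=1}^T\mathbb I\{S[t]=\emptyset\}\Big),\qquad \gamma_{\mathrm o}(U)=-\liminf_{K\to\infty}\frac1K\log\mathbb P_{\mathrm o}^{K,U}.$$ Let $\Omega=\{x\in\mathbb R^{V_S}:x\ge0,\ \sum_i x_i=1\}$. For $\alpha\in\mathrm{relint}(\Omega)$ and $x\in\mathbb R^{V_S}$ let $L_\alpha(x)=1-\min_i x_i/\alpha_i$. For $f\in\mathbb R^{V_D\times V_S}$ let $\Lambda^*(f)=\sum_{j',k}f_{j'k}\log(f_{j'k}/\phi_{j'k})$ if $f\ge0$ and $\sum_{j',k} f_{j'k}=1$ (with $0\log(0/q)=0$, and $p\log(p/0)=\infty$ for $p>0$), and $\Lambda^*(f)=\infty$ otherwise. Let $\mathcal X_f$ be the set of all $\Delta x\in\mathbb R^{V_S}$ of the form $$\Delta x_i=\sum_{j'\in V_D}f_{j'i}-\sum_{j'\in\partial(i)}d_{ij'}\sum_{k\in V_S}f_{j'k}\quad(i\in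 V_S)$$ with $d_{ij'}\ge0$ and $\sum_{i\in\partial(j')}d_{ij'}=1$ for all $j'\in V_D$. Finally let $$v_\alpha(f)=\min_{\Delta x\in\mathcal X_f}L_\alpha(\alpha+\Delta x)\quad(+\infty\text{ if }\mathcal X_f=\emptyset),\qquad \gamma_{\mathrm{CB}}(\alpha)=\inf_{f:\,v_\alpha(f)>0}\frac{\Lambda^*(f)}{v_\alpha(f)},$$ where a quotient with $v_\alpha(f)=+\infty$ is $0$. **Lemma.** For every stationary policy $U$ and every $\epsilon>0$ there exists $\alpha\in\mathrm{relint}(\Omega)$ such that $$\gamma_{\mathrm o}(U)\le\gamma_{\mathrm{CB}}(\alpha)+\epsilon.$$ In particular, $\gamma_{\mathrm o}(U)\le\sup_{\alpha\in\mathrm{relint}(\Omega)}\gamma_{\mathrm{CB}}(\alpha)$. -/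

import Mathlib

open Filter MeasureTheory
open scoped ENNReal

namespace RideHailing

/-- A network: a bipartite compatibility graph between `n` supply nodes and `m` demand nodes, and
normalized demand arrival rates `φ j k` (origin `j`, destination `k`). Demand nodes
with zero arrival rate are not part of the network. -/
structure Network (m n : ℕ) where
  /-- `(i, j) ∈ edges`: supply stationed at `i` can serve demand arriving at `j`. -/
  edges : Finset (Fin n × Fin m)
  φ : Fin m → Fin n → ℝ
  φ_nonneg : ∀ j k, 0 ≤ φ j k
  φ_sum : ∑ j, ∑ k, φ j k = 1
  φ_row_pos : ∀ j, 0 < ∑ k, φ j k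

variable {m n : ℕ}

namespace Network

/-- The neighbourhood `∂(j)` of a demand node. -/
def suppliers (N : Network m n) (j : Fin m) : Finset (Fin n) :=
  Finset.univ.filter fun i => (i, j) ∈ N.edges

/-- The neighbourhood `∂(i)` of a supply node. -/
def demands (N : Network m n) (i : Fin n) : Finset (Fin m) :=
  Finset.univ.filter fun j => (i, j) ∈ N.edges

/-- Some demand type has positive rate and a destination that is not compatible
with its origin. -/
def NonTrivial (N : Network m n) : Prop :=
  ∃ j k, k ∉ N.suppliers j ∧ 0 < N.φ j k

end Network

/-- The states of the system with `K` supply units. -/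
abbrev State (n K : ℕ) : Type := {x : Fin n → ℕ // ∑ i, x i = K}

/-- A stationary assignment policy for the system with `K` supply units. The value `none` means
that the demand is dropped; `some i` means that a unit currently at `i` serves it. -/
structure Policy (N : Network m n) (K : ℕ) where
  assign : State n K → Fin m → Fin n → Option (Fin n)
  feasible : ∀ x j k i, assign x j k = some i → i ∈ N.suppliers j ∧ 0 < x.1 i

/-- Move one supply unit from `i` to `k`. -/
def move (x : Fin n → ℕ) (i k : Fin n) : Fin n → ℕ :=
  x - Pi.single i 1 + Pi.single k 1

theorem sum_move (x : Fin n → ℕ) (i k : Fin n) (hi : 0 < x i) :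
    ∑ l, move x i k l = ∑ l, x l := by
  have hle : (Pi.single i 1 : Fin n → ℕ) ≤ x := by
    intro l
    by_cases h : l = i
    · subst h; have h1 : 1 ≤ x l := hi; simpa using h1
    · simp [h]
  have h : (x - Pi.single i 1) + Pi.single i 1 = x := tsub_add_cancel_of_le hle
  have h2 : ∑ l, ((x - Pi.single i 1) + Pi.single i 1 : Fin n → ℕ) l = ∑ l, x l := by rw [h]
  rw [← h2]
  simp only [move, Pi.add_apply, Finset.sum_add_distrib, Finset.sum_pi_single',
    Finset.mem_univ, if_true]

namespace Policy

variable {N : Network m n} {K : ℕ}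

/-- One time slot: a demand with origin `a.1` and destination `a.2` arrives in state `x`. -/
def step (U : Policy N K) (x : State n K) (a : Fin m × Fin n) : State n K :=
  match h : U.assign x a.1 a.2 with
  | none => x
  | some i => ⟨move x.1 i a.2, (sum_move x.1 i a.2 (U.feasible x a.1 a.2 i h).2).trans x.2⟩

/-- The state after `t` slots, from the initial state `x₀`, when `ω s` is the demand that
arrives in the slot following state number `s`. -/
def traj (U : Policy N K) (x₀ : State n K) (ω : ℕ → Fin m × Fin n) : ℕ → State n K
  | 0 => x₀
  | t + 1 => U.step (traj U x₀ ω t) (ω t)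

/-- The fraction of the first `T` demands that are dropped. -/
noncomputable def dropFraction (U : Policy N K) (x₀ : State n K) (ω : ℕ → Fin m × Fin n)
    (T : ℕ) : ℝ≥0∞ :=
  (∑ t ∈ Finset.range T,
    if U.assign (U.traj x₀ ω t) (ω t).1 (ω t).2 = none then (1 : ℝ≥0∞) else 0) / T

end Policy

namespace Network

/-- The law of the origin-destination pair of one demand. -/
noncomputable def arrivalPMF (N : Network m n) : PMF (Fin m × Fin n) :=
  PMF.ofFintype (fun a => ENNReal.ofReal (N.φ a.1 a.2)) (by
    rw [← ENNReal.ofReal_sum_of_nonneg (fun a _ => N.φ_nonneg a.1 a.2), Fintype.sum_prod_type,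
      N.φ_sum, ENNReal.ofReal_one])

/-- The law of the i.i.d. sequence of demands. -/
noncomputable def arrivalLaw (N : Network m n) : Measure (ℕ → Fin m × Fin n) :=
  Measure.infinitePi fun _ => N.arrivalPMF.toMeasure

end Network

/-- The optimistic long-run average demand-drop probability: the minimum over the initial state
of the expected limit of the fraction of dropped demands. The limit exists almost surely; `liminf`
is its value wherever it exists. -/
noncomputable def optimisticDropProb {N : Network m n} {K : ℕ} (U : Policy N K) : ℝ≥0∞ :=
  ⨅ x₀ : State n K, ∫⁻ ω, liminf (fun T => U.dropFraction x₀ ω T) atTop ∂N.arrivalLaw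

/-- The optimistic demand-drop exponent of a policy, with `log 0 = -∞`. -/
noncomputable def optimisticExponent {N : Network m n} (U : ∀ K, Policy N K) : EReal :=
  -liminf (fun K : ℕ => ENNReal.log (optimisticDropProb (U K)) / ((K : ℝ) : EReal)) atTop

namespace Network

open Classical in
/-- Kullback-Leibler divergence of `f` from `φ`, with the usual conventions
`0 log (0 / q) = 0` and `p log (p / 0) = ∞` for `p ≠ 0`. -/
noncomputable def klDivergence (N : Network m n) (f : Fin m → Fin n → ℝ) : EReal :=
  if ∀ j k, N.φ j k = 0 → f j k = 0 then
    ((∑ j, ∑ k, f j k * Real.log (f j k / N.φ j k) : ℝ) : EReal)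
  else ⊤

open Classical in
/-- The large-deviation cost `Λ*(f)` of an arrival rate matrix. -/
noncomputable def rate (N : Network m n) (f : Fin m → Fin n → ℝ) : EReal :=
  if (∀ j k, 0 ≤ f j k) ∧ ∑ j, ∑ k, f j k = 1 then N.klDivergence f else ⊤

/-- The attainable changes of the normalized state in unit time, under arrival rates `f` and
without dropped demand: `d i j` is the fraction of the demand at `j` served from `i`. -/
def attainable (N : Network m n) (f : Fin m → Fin n → ℝ) : Set (Fin n → ℝ) :=
  {Δ | ∃ d : Fin n → Fin m → ℝ,
    (∀ i, Δ i = (∑ j, f j i) - ∑ j ∈ N.demands i, d i j * (∑ k, f j k)) ∧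
    (∀ j, ∑ i ∈ N.suppliers j, d i j = 1) ∧ ∀ i j, 0 ≤ d i j}

end Network

/-- The Lyapunov function `L_α(x) = 1 - min_i x_i / α_i`. -/
noncomputable def lyapunov (α x : Fin n → ℝ) : ℝ :=
  1 - ⨅ i, x i / α i

namespace Network

/-- The minimal growth rate `v_α(f)` of the Lyapunov function under arrival rates `f`
(`+∞` if there is no attainable change at all). -/
noncomputable def growthRate (N : Network m n) (α : Fin n → ℝ) (f : Fin m → Fin n → ℝ) : EReal :=
  ⨅ Δ ∈ N.attainable f, ((lyapunov α (α + Δ) : ℝ) : EReal)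

/-- The converse bound `γ_CB(α)`. -/
noncomputable def converseBound (N : Network m n) (α : Fin n → ℝ) : EReal :=
  ⨅ (f : Fin m → Fin n → ℝ) (_ : 0 < N.growthRate α f), N.rate f / N.growthRate α f

end Network

/-- The relative interior of the probability simplex. -/
def simplexInterior (n : ℕ) : Set (Fin n → ℝ) :=
  intrinsicInterior ℝ (stdSimplex ℝ (Fin n))

end RideHailing

/-! Fix `α` and rates `f` with `v_α(f) > 0`. If the empirical demand over `L` slots is close to `f`
and nothing is dropped, the net displacement is close to `L` times an attainable change, so some
coordinate `i` loses about `L v_α(f) α i` units or more. From a state below `(1 + δ) K α` this is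
impossible once `L` slightly exceeds `(1 + δ) K / v_α(f)`: a drop must occur, whatever the policy
(`dropCount_pos_of_mem_typicalSet`). A change of measure (`iidLaw_typicalSet_le`) bounds the
probability of such demand below by roughly `exp (-L Λ*(f))`. Optimizing over `f` gives drop
probability at least `exp (-s K)` within `O(K)` slots, with `s ≤ γ_CB(α) + ε`
(`exists_window_of_converseBound`).

The states from which this works for a given `α` form a neighbourhood of `α` after scaling by `K`.
By compactness finitely many `α` serve all states; the one with the largest `s` gives a bound from
every state. Restarting block after block turns it into a lower bound on the long-run drop frequency
that loses only a factor linear in `K` (`le_optimisticDropProb`), which is invisible to the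
exponent. -/

namespace RideHailing

/-! ### Words, letter counts and typical sequences -/

section Words

variable {A : Type*}

/-- A function of the first `T` letters factors through words of length `T`. -/
theorem exists_word_factorization [Nonempty A] {β : Type*} {T : ℕ} {F : (ℕ → A) → β}
    (hF : DependsOn F (Set.Iio T)) :
    ∃ Ψ : (Fin T → A) → β, ∀ ω, F ω = Ψ fun i => ω i := by
  refine ⟨fun w => F fun t => if h : t < T then w ⟨t, h⟩ else Classical.arbitrary A, fun ω => ?_⟩
  refine hF fun t ht => ?_
  simp [Set.mem_Iio.1 ht]

/-- The number of occurrences of `a` among the first `L` letters. -/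
noncomputable def letterCount (ω : ℕ → A) (L : ℕ) (a : A) : ℝ :=
  ∑ t ∈ Finset.range L, Set.indicator {a} (fun _ => (1 : ℝ)) (ω t)

/-- The sequences whose first `L` letters have empirical distribution within `η` of `f`. -/
def typicalSet (f : A → ℝ) (η : ℝ) (L : ℕ) : Set (ℕ → A) :=
  {ω | ∀ a, |letterCount ω L a - L * f a| ≤ L * η}

theorem dependsOn_letterCount (L : ℕ) (a : A) :
    DependsOn (fun ω => letterCount ω L a) (Set.Iio L) := by
  intro ω ω' h
  refine Finset.sum_congr rfl fun t ht => ?_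
  rw [h t (Finset.mem_range.1 ht)]

theorem dependsOn_mem_typicalSet (f : A → ℝ) (η : ℝ) (L : ℕ) :
    DependsOn (fun ω => ω ∈ typicalSet f η L) (Set.Iio L) := by
  intro ω ω' h
  have : ∀ a, letterCount ω L a = letterCount ω' L a := fun a => dependsOn_letterCount L a h
  simp [typicalSet, this]

end Words

/-! ### I.i.d. letters and the law of large numbers -/

section IID

variable {A : Type*} [Fintype A] [MeasurableSpace A] [MeasurableSingletonClass A]

/-- The law of an i.i.d. sequence with common law `p`. -/
noncomputable def iidLaw (p : PMF A) : Measure (ℕ → A) :=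
  Measure.infinitePi fun _ => p.toMeasure

instance (p : PMF A) : IsProbabilityMeasure (iidLaw p) := by
  unfold iidLaw; infer_instance

theorem lintegral_iidLaw_word (p : PMF A) (L : ℕ) (F : (Fin L → A) → ℝ≥0∞) :
    ∫⁻ ω, F (fun i => ω i) ∂iidLaw p = ∑ w : Fin L → A, (∏ i, p (w i)) * F w := by
  have hmap : (iidLaw p).map (fun ω (i : Fin L) => ω i) =
      Measure.infinitePi fun _ : Fin L => p.toMeasure :=
    Measure.map_infinitePi_infinitePi_of_inj (P := fun _ : ℕ => p.toMeasure) Fin.val_injective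
  have hF : Measurable F := measurable_of_finite F
  have hres : Measurable fun (ω : ℕ → A) (i : Fin L) => ω i := by fun_prop
  rw [← lintegral_map hF hres, hmap, lintegral_fintype]
  refine Finset.sum_congr rfl fun w _ => ?_
  rw [Measure.infinitePi_singleton_of_fintype, mul_comm]
  simp only [PMF.toMeasure_apply_singleton _ _ (measurableSet_singleton _)]

theorem measurable_of_dependsOn_Iio [Nonempty A] {β : Type*} [MeasurableSpace β] {T : ℕ}
    {F : (ℕ → A) → β} (hF : DependsOn F (Set.Iio T)) : Measurable F := by
  obtain ⟨Ψ, hΨ⟩ := exists_word_factorization hF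
  rw [funext hΨ]
  exact (measurable_of_finite Ψ).comp (by fun_prop)

/-- The letter number `T` may be averaged out independently of the earlier ones. -/
theorem lintegral_iidLaw_next [Nonempty A] (p : PMF A) {T : ℕ} {G : (ℕ → A) → A → ℝ≥0∞}
    (hG : DependsOn G (Set.Iio T)) :
    ∫⁻ ω, G ω (ω T) ∂iidLaw p = ∫⁻ ω, ∑ a, p a * G ω a ∂iidLaw p := by
  obtain ⟨Ψ, hΨ⟩ := exists_word_factorization hG
  simp only [hΨ]
  rw [lintegral_iidLaw_word p T fun w => ∑ a, p a * Ψ w a]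
  have h := lintegral_iidLaw_word p (T + 1) fun w => Ψ (fun i => w i.castSucc) (w (Fin.last T))
  simp only [Fin.val_castSucc, Fin.val_last] at h
  rw [h, ← (Fin.snocEquiv fun _ : Fin (T + 1) => A).sum_comp, Fintype.sum_prod_type,
    Finset.sum_comm]
  refine Finset.sum_congr rfl fun w _ => ?_
  rw [Finset.mul_sum]
  refine Finset.sum_congr rfl fun a _ => ?_
  simp [Fin.snocEquiv, Fin.prod_univ_castSucc, mul_assoc]

theorem ae_tendsto_letterCount (p : PMF A) (a : A) :
    ∀ᵐ ω ∂iidLaw p, Tendsto (fun L : ℕ => letterCount ω L a / L) atTop (nhds (p a).toReal) := by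
  have hm : Measurable (Set.indicator {a} (fun _ : A => (1 : ℝ))) := measurable_of_finite _
  have hi : ProbabilityTheory.iIndepFun
      (fun (i : ℕ) (ω : ℕ → A) => Set.indicator {a} (fun _ => (1 : ℝ)) (ω i)) (iidLaw p) :=
    ProbabilityTheory.iIndepFun_infinitePi (X := fun _ => Set.indicator {a} (fun _ => (1 : ℝ)))
      fun _ => hm
  have hmap : ∀ i : ℕ, (iidLaw p).map (fun ω : ℕ → A => ω i) = p.toMeasure := fun i =>
    Measure.infinitePi_map_eval (fun _ : ℕ => p.toMeasure) i
  have h := ProbabilityTheory.strong_law_ae_real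
    (fun (i : ℕ) (ω : ℕ → A) => Set.indicator {a} (fun _ => (1 : ℝ)) (ω i)) (μ := iidLaw p)
    (by
      refine Integrable.of_bound (C := 1) (hm.comp (measurable_pi_apply 0)).aestronglyMeasurable
        (Eventually.of_forall fun ω => ?_)
      by_cases hω : ω 0 = a <;> simp [hω])
    (fun i j hij => hi.indepFun hij)
    (fun i => by
      have : ProbabilityTheory.IdentDistrib (fun ω : ℕ → A => ω i) (fun ω => ω 0)
          (iidLaw p) (iidLaw p) :=
        ⟨(measurable_pi_apply i).aemeasurable, (measurable_pi_apply 0).aemeasurable, by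
          rw [hmap, hmap]⟩
      exact this.comp hm)
  have hmean : ∫ ω, Set.indicator {a} (fun _ => (1 : ℝ)) (ω 0) ∂iidLaw p = (p a).toReal := by
    rw [← integral_map (φ := fun ω : ℕ → A => ω 0)
      (measurable_pi_apply 0).aemeasurable hm.aestronglyMeasurable, hmap,
      integral_indicator (measurableSet_singleton a)]
    rw [setIntegral_const, Measure.real,
      PMF.toMeasure_apply_singleton _ _ (measurableSet_singleton a)]
    simp
  rw [hmean] at h
  exact h

theorem measurableSet_typicalSet [Nonempty A] (f : A → ℝ) (η : ℝ) (L : ℕ) :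
    MeasurableSet (typicalSet f η L) :=
  measurableSet_setOfPred.2 (measurable_of_dependsOn_Iio (dependsOn_mem_typicalSet f η L))

/-- By the strong law almost every sequence is eventually typical, so the probabilities tend to 1 by
dominated convergence. Any constant below 1 would serve in place of `1 / 2`. -/
theorem eventually_half_le_typicalSet [Nonempty A] (p : PMF A) {η : ℝ} (hη : 0 < η) :
    ∀ᶠ L : ℕ in atTop, (1 / 2 : ℝ≥0∞) ≤ iidLaw p (typicalSet (fun a => (p a).toReal) η L) := by
  have h : ∀ᵐ ω ∂iidLaw p, ∀ᶠ L : ℕ in atTop, ω ∈ typicalSet (fun a => (p a).toReal) η L := by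
    filter_upwards [ae_all_iff.2 (ae_tendsto_letterCount p)] with ω hω
    have h1 : ∀ᶠ L : ℕ in atTop, ∀ a, |letterCount ω L a / L - (p a).toReal| < η :=
      eventually_all.2 fun a => by
        simpa [Real.dist_eq] using Metric.tendsto_nhds.1 (hω a) η hη
    filter_upwards [h1, eventually_gt_atTop 0] with L hL hL0 a
    have hL0' : (0 : ℝ) < L := by exact_mod_cast hL0
    have e : letterCount ω L a - L * (p a).toReal
        = L * (letterCount ω L a / L - (p a).toReal) := by field_simp
    rw [e, abs_mul, abs_of_pos hL0']
    exact mul_le_mul_of_nonneg_left (hL a).le hL0'.le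
  have ht : Tendsto (fun L : ℕ => ∫⁻ ω, (typicalSet (fun a => (p a).toReal) η L).indicator 1 ω
      ∂iidLaw p) atTop (nhds (∫⁻ _, 1 ∂iidLaw p)) := by
    refine tendsto_lintegral_of_dominated_convergence (fun _ => 1)
      (fun L => measurable_one.indicator (measurableSet_typicalSet _ _ _))
      (fun L => Eventually.of_forall fun ω => Set.indicator_le_self' (by simp) ω) (by simp) ?_
    filter_upwards [h] with ω hω
    refine tendsto_const_nhds.congr' ?_
    filter_upwards [hω] with L hL
    simp [hL]
  simp only [lintegral_indicator_one (measurableSet_typicalSet _ _ _), lintegral_one,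
    measure_univ] at ht
  exact (ht.eventually_const_lt (by simp : (1 / 2 : ℝ≥0∞) < 1)).mono fun L hL => hL.le

end IID

variable {m n : ℕ}

/-! ### From a uniform drop probability per block to the long-run drop frequency -/

namespace Policy

variable {N : Network m n} {K : ℕ}

/-- The number of demands dropped in the first `T` slots. -/
def dropCount (U : Policy N K) (x₀ : State n K) (ω : ℕ → Fin m × Fin n) (T : ℕ) : ℕ :=
  ∑ t ∈ Finset.range T, if U.assign (U.traj x₀ ω t) (ω t).1 (ω t).2 = none then 1 else 0

theorem dropFraction_eq (U : Policy N K) (x₀ : State n K) (ω : ℕ → Fin m × Fin n) (T : ℕ) :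
    U.dropFraction x₀ ω T = (U.dropCount x₀ ω T : ℝ≥0∞) / T := by
  simp [dropFraction, dropCount]

theorem dropCount_mono (U : Policy N K) (x₀ : State n K) (ω : ℕ → Fin m × Fin n) :
    Monotone (U.dropCount x₀ ω) := fun _ _ h =>
  Finset.sum_le_sum_of_subset (Finset.range_mono h)

theorem dependsOn_traj (U : Policy N K) (x₀ : State n K) (T : ℕ) :
    DependsOn (fun ω => U.traj x₀ ω T) (Set.Iio T) := by
  induction T with
  | zero => intro _ _ _; rfl
  | succ T ih =>
    intro ω ω' h
    have h1 : U.traj x₀ ω T = U.traj x₀ ω' T :=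
      ih fun t ht => h t (lt_trans ht (Nat.lt_succ_self T))
    simp only [traj, h1, h T (Nat.lt_succ_self T)]

theorem dependsOn_dropCount (U : Policy N K) (x₀ : State n K) (T : ℕ) :
    DependsOn (fun ω => U.dropCount x₀ ω T) (Set.Iio T) := by
  intro ω ω' h
  refine Finset.sum_congr rfl fun t ht => ?_
  have ht' := Finset.mem_range.1 ht
  have h1 : U.traj x₀ ω t = U.traj x₀ ω' t :=
    U.dependsOn_traj x₀ t fun s hs => h s (lt_trans hs ht')
  rw [h t ht', h1]

/-- The transition operator of the state chain in which every drop costs a factor `1 / 2`. -/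
noncomputable def discount (U : Policy N K) (h : State n K → ℝ≥0∞) (x : State n K) : ℝ≥0∞ :=
  ∑ a, N.arrivalPMF a * ((if U.assign x a.1 a.2 = none then 1 / 2 else 1) * h (U.step x a))

theorem discount_mono (U : Policy N K) : Monotone U.discount := by
  intro h h' hh x
  unfold discount
  gcongr
  exact hh _

theorem discount_smul (U : Policy N K) (c : ℝ≥0∞) (h : State n K → ℝ≥0∞) :
    U.discount (c • h) = c • U.discount h := by
  ext x
  simp only [discount, Pi.smul_apply, smul_eq_mul, Finset.mul_sum]
  refine Finset.sum_congr rfl fun a _ => ?_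
  ring

theorem discount_iterate_smul (U : Policy N K) (c : ℝ≥0∞) (h : State n K → ℝ≥0∞) (T : ℕ) :
    U.discount^[T] (c • h) = c • U.discount^[T] h := by
  induction T with
  | zero => rfl
  | succ T ih => rw [Function.iterate_succ_apply', ih, discount_smul, Function.iterate_succ_apply']

/-- Markov property: the last letter is independent of the state and drop count before it, so
averaging it out replaces `h` by `U.discount h`. -/
theorem lintegral_discounted (U : Policy N K) [Nonempty (Fin m × Fin n)] (x₀ : State n K) (T : ℕ)
    (h : State n K → ℝ≥0∞) :
    ∫⁻ ω, (1 / 2) ^ U.dropCount x₀ ω T * h (U.traj x₀ ω T) ∂N.arrivalLaw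
      = U.discount^[T] h x₀ := by
  induction T generalizing h with
  | zero =>
    have : IsProbabilityMeasure N.arrivalLaw :=
      inferInstanceAs (IsProbabilityMeasure (iidLaw N.arrivalPMF))
    simp [dropCount, traj]
  | succ T ih =>
    rw [Function.iterate_succ_apply, ← ih]
    have := lintegral_iidLaw_next N.arrivalPMF (T := T)
      (G := fun ω a => (1 / 2) ^ U.dropCount x₀ ω T *
        ((if U.assign (U.traj x₀ ω T) a.1 a.2 = none then 1 / 2 else 1) *
          h (U.step (U.traj x₀ ω T) a)))
      (by
        intro ω ω' hω
        have h1 : U.dropCount x₀ ω T = U.dropCount x₀ ω' T := U.dependsOn_dropCount x₀ T hω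
        have h2 : U.traj x₀ ω T = U.traj x₀ ω' T := U.dependsOn_traj x₀ T hω
        simp only [h1, h2])
    calc _ = _ := lintegral_congr fun ω => ?_
      _ = _ := this
      _ = _ := lintegral_congr fun ω => ?_
    · simp only [dropCount, Finset.sum_range_succ, pow_add, traj, mul_assoc]
      split_ifs <;> simp
    · simp only [discount, Finset.mul_sum]
      refine Finset.sum_congr rfl fun a _ => ?_
      ring

theorem measurable_dropCount [Nonempty (Fin m × Fin n)] (U : Policy N K) (x₀ : State n K) (T : ℕ) :
    Measurable fun ω => U.dropCount x₀ ω T :=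
  measurable_of_dependsOn_Iio (U.dependsOn_dropCount x₀ T)

/-- Integrate the pointwise inequality `(1 / 2) ^ D + (1 / 2) * 1_{D > 0} ≤ 1` for the drop count
`D`. -/
theorem discount_iterate_one_le [Nonempty (Fin m × Fin n)] (U : Policy N K) (L : ℕ) {p : ℝ}
    (hp : 0 ≤ p) {x₀ : State n K}
    (hx : ENNReal.ofReal p ≤ N.arrivalLaw {ω | 0 < U.dropCount x₀ ω L}) :
    U.discount^[L] 1 x₀ ≤ ENNReal.ofReal (1 - p / 2) := by
  have : IsProbabilityMeasure N.arrivalLaw :=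
    inferInstanceAs (IsProbabilityMeasure (iidLaw N.arrivalPMF))
  have hm : MeasurableSet {ω | 0 < U.dropCount x₀ ω L} :=
    measurableSet_lt measurable_const (U.measurable_dropCount x₀ L)
  rw [← lintegral_discounted]
  have hsum : ∫⁻ ω, (1 / 2) ^ U.dropCount x₀ ω L * (1 : State n K → ℝ≥0∞) (U.traj x₀ ω L)
        ∂N.arrivalLaw + ENNReal.ofReal (p / 2) ≤ 1 := by
    calc _ ≤ ∫⁻ ω, (1 / 2) ^ U.dropCount x₀ ω L * (1 : State n K → ℝ≥0∞) (U.traj x₀ ω L)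
            ∂N.arrivalLaw +
          ∫⁻ ω, {ω | 0 < U.dropCount x₀ ω L}.indicator (fun _ => (1 / 2 : ℝ≥0∞)) ω
            ∂N.arrivalLaw := by
          gcongr
          rw [lintegral_indicator_const hm, div_eq_mul_inv, mul_comm,
            ENNReal.ofReal_mul (by norm_num), ENNReal.ofReal_inv_of_pos (by norm_num), one_div]
          simp only [ENNReal.ofReal_ofNat]
          gcongr
      _ = ∫⁻ ω, ((1 / 2) ^ U.dropCount x₀ ω L * (1 : State n K → ℝ≥0∞) (U.traj x₀ ω L) +
            {ω | 0 < U.dropCount x₀ ω L}.indicator (fun _ => (1 / 2 : ℝ≥0∞)) ω)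
            ∂N.arrivalLaw :=
          (lintegral_add_right _ (measurable_const.indicator hm)).symm
      _ ≤ ∫⁻ _, 1 ∂N.arrivalLaw := by
          refine lintegral_mono fun ω => ?_
          by_cases h : 0 < U.dropCount x₀ ω L
          · obtain ⟨k, hk⟩ := Nat.exists_eq_add_of_lt h
            simp only [Set.indicator, Set.mem_ofPred_eq, h, if_true, Pi.one_apply, mul_one]
            rw [hk, zero_add, pow_succ]
            calc _ ≤ (1 : ℝ≥0∞) * (1 / 2) + 1 / 2 := by
                  gcongr
                  exact pow_le_one₀ (by simp) (by simp)
              _ = 1 := by rw [one_mul]; exact ENNReal.add_halves 1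
          · have h0 : U.dropCount x₀ ω L = 0 := by omega
            simp [h0]
      _ = 1 := by simp
  rw [ENNReal.ofReal_sub _ (by positivity), ENNReal.ofReal_one]
  exact ENNReal.le_sub_of_add_le_right ENNReal.ofReal_ne_top hsum

/-- The one-block bound holds from every state, so the value of the remaining blocks is dominated by
a constant function, which homogeneity of `discount` pulls out. -/
theorem discount_iterate_mul_le (U : Policy N K) (L : ℕ) {q : ℝ≥0∞}
    (hx : ∀ x, U.discount^[L] 1 x ≤ q) (B : ℕ) (x : State n K) :
    U.discount^[L * B] 1 x ≤ q ^ B := by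
  induction B generalizing x with
  | zero => simp
  | succ B ih =>
    rw [Nat.mul_succ, add_comm, Function.iterate_add_apply]
    have h1 : U.discount^[L * B] 1 ≤ q ^ B • (1 : State n K → ℝ≥0∞) := fun y => by
      simpa using ih y
    calc _ ≤ U.discount^[L] (q ^ B • 1) x := U.discount_mono.iterate L h1 x
      _ = q ^ B * U.discount^[L] 1 x := by rw [discount_iterate_smul]; rfl
      _ ≤ q ^ B * q := by gcongr; exact hx x
      _ = q ^ (B + 1) := (pow_succ _ _).symm

/-- Too few drops in `B` blocks of length `L` are exponentially unlikely. -/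
theorem measure_dropCount_le [Nonempty (Fin m × Fin n)] (U : Policy N K) (L : ℕ) {p : ℝ}
    (hp : 0 ≤ p) (hp1 : p ≤ 1)
    (hx : ∀ x, ENNReal.ofReal p ≤ N.arrivalLaw {ω | 0 < U.dropCount x ω L})
    (x₀ : State n K) (B : ℕ) :
    N.arrivalLaw {ω | (U.dropCount x₀ ω (L * B) : ℝ) ≤ p / 4 * B}
      ≤ ENNReal.ofReal (Real.exp (-(p / 4))) ^ B := by
  have hb := U.discount_iterate_mul_le L (fun x => U.discount_iterate_one_le L hp (hx x)) B x₀
  rw [← lintegral_discounted] at hb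
  have hmeas : Measurable fun ω => ((1 / 2 : ℝ≥0∞)) ^ U.dropCount x₀ ω (L * B) :=
    (measurable_of_countable fun k : ℕ => (1 / 2 : ℝ≥0∞) ^ k).comp (U.measurable_dropCount x₀ _)
  -- Chernoff bound: Markov's inequality for `(1 / 2) ^ dropCount`, with `exp (-1) ≤ 1 / 2` here and
  -- `1 - p / 2 ≤ exp (-(p / 2))` below.
  have hsub : {ω | (U.dropCount x₀ ω (L * B) : ℝ) ≤ p / 4 * B} ⊆
      {ω | ENNReal.ofReal (Real.exp (-(p / 4 * B))) ≤ (1 / 2) ^ U.dropCount x₀ ω (L * B)} := by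
    intro ω hω
    simp only [Set.mem_ofPred_eq] at hω ⊢
    have e : (1 / 2 : ℝ≥0∞) = ENNReal.ofReal (1 / 2) := by
      rw [ENNReal.ofReal_div_of_pos (by norm_num)]; simp
    rw [e, ← ENNReal.ofReal_pow (by norm_num)]
    refine ENNReal.ofReal_le_ofReal ?_
    have h2 : Real.exp (-1) ≤ 1 / 2 := by
      rw [Real.exp_neg, one_div]
      exact inv_anti₀ (by norm_num) (by linarith [Real.add_one_le_exp (1 : ℝ)])
    calc Real.exp (-(p / 4 * B)) ≤ Real.exp (-(U.dropCount x₀ ω (L * B) : ℝ)) := by gcongr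
      _ = Real.exp (-1) ^ U.dropCount x₀ ω (L * B) := by
          rw [← Real.exp_nat_mul]; congr 1; ring
      _ ≤ _ := by gcongr
  have hpos : ENNReal.ofReal (Real.exp (-(p / 4 * B))) ≠ 0 := by
    simp [Real.exp_pos]
  have hM := mul_meas_ge_le_lintegral (μ := N.arrivalLaw) hmeas
    (ENNReal.ofReal (Real.exp (-(p / 4 * B))))
  have hb' : ∫⁻ ω, (1 / 2 : ℝ≥0∞) ^ U.dropCount x₀ ω (L * B) ∂N.arrivalLaw
      ≤ ENNReal.ofReal (Real.exp (-(p / 4 * B))) * ENNReal.ofReal (Real.exp (-(p / 4))) ^ B := by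
    refine (le_of_eq ?_).trans (hb.trans ?_)
    · simp
    · rw [← ENNReal.ofReal_pow (by linarith), ← ENNReal.ofReal_pow (Real.exp_pos _).le,
        ← ENNReal.ofReal_mul (Real.exp_pos _).le]
      refine ENNReal.ofReal_le_ofReal ?_
      calc (1 - p / 2) ^ B ≤ Real.exp (-(p / 2)) ^ B := by
            gcongr
            · linarith
            · linarith [Real.add_one_le_exp (-(p / 2))]
        _ = _ := by
            rw [← Real.exp_nat_mul, ← Real.exp_nat_mul, ← Real.exp_add]; congr 1; ring
  have := (mul_le_mul_right (measure_mono hsub) _).trans (hM.trans hb')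
  exact (ENNReal.mul_le_mul_iff_right hpos ENNReal.ofReal_ne_top).1 this

/-- By Borel–Cantelli, eventually more than `p / 4` drops per block occur. Rounding `T` down to
whole blocks costs at most a factor 2, whence `8 * L`. -/
theorem ae_le_liminf_dropFraction [Nonempty (Fin m × Fin n)] (U : Policy N K) {L : ℕ}
    (hL : 0 < L) {p : ℝ} (hp : 0 < p) (hp1 : p ≤ 1)
    (hx : ∀ x, ENNReal.ofReal p ≤ N.arrivalLaw {ω | 0 < U.dropCount x ω L})
    (x₀ : State n K) :
    ∀ᵐ ω ∂N.arrivalLaw,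
      ENNReal.ofReal (p / (8 * L)) ≤ liminf (fun T => U.dropFraction x₀ ω T) atTop := by
  have hsum : ∑' B, N.arrivalLaw {ω | (U.dropCount x₀ ω (L * B) : ℝ) ≤ p / 4 * B} ≠ ∞ := by
    refine ne_top_of_le_ne_top ?_
      (ENNReal.tsum_le_tsum fun B => U.measure_dropCount_le L hp.le hp1 hx x₀ B)
    rw [ENNReal.tsum_geometric]
    refine ENNReal.inv_ne_top.2 (tsub_pos_of_lt ?_).ne'
    rw [ENNReal.ofReal_lt_one, Real.exp_lt_one_iff]
    linarith
  filter_upwards [ae_eventually_notMem hsum] with ω hω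
  refine le_liminf_of_le (by isBoundedDefault) ?_
  have hdiv : Tendsto (fun T : ℕ => T / L) atTop atTop := Nat.tendsto_div_const_atTop hL.ne'
  filter_upwards [hdiv.eventually hω, eventually_ge_atTop L] with T hT hTL
  replace hT := not_le.1 hT
  have hL' : (0 : ℝ) < L := by exact_mod_cast hL
  have hT0 : (0 : ℝ) < T := lt_of_lt_of_le hL' (by exact_mod_cast hTL)
  have h1 : (U.dropCount x₀ ω (L * (T / L)) : ℝ) ≤ U.dropCount x₀ ω T := by
    exact_mod_cast U.dropCount_mono x₀ ω (Nat.mul_div_le T L)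
  have h2 : (T : ℝ) ≤ 2 * L * (T / L : ℕ) := by
    have hq : 1 ≤ T / L := (Nat.one_le_div_iff hL).2 hTL
    have h3 := Nat.div_add_mod T L
    have h4 := Nat.mod_lt T hL
    have h5 : T ≤ 2 * L * (T / L) := by nlinarith
    exact_mod_cast h5
  rw [dropFraction_eq, ← ENNReal.ofReal_natCast, ← ENNReal.ofReal_natCast,
    ← ENNReal.ofReal_div_of_pos hT0]
  refine ENNReal.ofReal_le_ofReal ?_
  rw [div_le_div_iff₀ (by positivity) hT0]
  calc p * T ≤ p * (2 * L * (T / L : ℕ)) := by gcongr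
    _ = p / 4 * (T / L : ℕ) * (8 * L) := by ring
    _ ≤ _ := by gcongr; exact (hT.trans_le h1).le

theorem le_optimisticDropProb [Nonempty (Fin m × Fin n)] (U : Policy N K) {L : ℕ} (hL : 0 < L)
    {p : ℝ} (hp : 0 < p) (hp1 : p ≤ 1)
    (hx : ∀ x, ENNReal.ofReal p ≤ N.arrivalLaw {ω | 0 < U.dropCount x ω L}) :
    ENNReal.ofReal (p / (8 * L)) ≤ optimisticDropProb U := by
  have : IsProbabilityMeasure N.arrivalLaw :=
    inferInstanceAs (IsProbabilityMeasure (iidLaw N.arrivalPMF))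
  refine le_iInf fun x₀ => ?_
  calc ENNReal.ofReal (p / (8 * L)) = ∫⁻ _, ENNReal.ofReal (p / (8 * L)) ∂N.arrivalLaw := by simp
    _ ≤ _ := lintegral_mono_ae (U.ae_le_liminf_dropFraction hL hp hp1 hx x₀)

end Policy

/-! ### Change of measure -/

section Tilt

variable {A : Type*} [Fintype A]

theorem sum_range_eq_sum_letterCount (ω : ℕ → A) (L : ℕ) (l : A → ℝ) :
    ∑ t ∈ Finset.range L, l (ω t) = ∑ a, letterCount ω L a * l a := by
  classical
  simp only [letterCount, Finset.sum_mul]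
  rw [Finset.sum_comm]
  refine Finset.sum_congr rfl fun t _ => ?_
  rw [Finset.sum_eq_single (ω t)]
  · simp
  · intro a _ ha
    simp [ha.symm]
  · simp

variable [MeasurableSpace A] [MeasurableSingletonClass A]

/-- Change of measure: the cost of making a letter distribution `q` typical under `p`. -/
theorem iidLaw_typicalSet_le [Nonempty A] (p q : PMF A) (hac : ∀ a, p a = 0 → q a = 0) (η : ℝ)
    (L : ℕ) :
    iidLaw q (typicalSet (fun a => (q a).toReal) η L) ≤
      ENNReal.ofReal (Real.exp (L * (∑ a, (q a).toReal * Real.log ((q a).toReal / (p a).toReal) +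
        η * ∑ a, |Real.log ((q a).toReal / (p a).toReal)|))) *
      iidLaw p (typicalSet (fun a => (q a).toReal) η L) := by
  classical
  set f : A → ℝ := fun a => (q a).toReal with hf
  set l : A → ℝ := fun a => Real.log ((q a).toReal / (p a).toReal) with hl
  obtain ⟨Ψ, hΨ⟩ := exists_word_factorization (dependsOn_mem_typicalSet f η L)
  have key : ∀ r : PMF A, iidLaw r (typicalSet f η L)
      = ∑ w : Fin L → A, (∏ i, r (w i)) * if Ψ w then 1 else 0 := by
    intro r
    rw [← lintegral_iidLaw_word, ← lintegral_indicator_one (measurableSet_typicalSet f η L)]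
    refine lintegral_congr fun ω => ?_
    simp only [← hΨ]
    simp [Set.indicator]
  rw [key q, key p, Finset.mul_sum]
  refine Finset.sum_le_sum fun w _ => ?_
  by_cases hw : Ψ w
  swap
  · simp [hw]
  simp only [hw, if_true, mul_one]
  set ω : ℕ → A := fun t => if h : t < L then w ⟨t, h⟩ else Classical.arbitrary A with hω
  have hωw : (fun i : Fin L => ω i) = w := by ext i; simp [hω]
  have hmem : ω ∈ typicalSet f η L := by
    have := hΨ ω
    rw [hωw] at this
    exact this.mpr hw
  have hpt : ∀ a, q a ≤ ENNReal.ofReal (Real.exp (l a)) * p a := by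
    intro a
    by_cases hq : q a = 0
    · simp [hq]
    have hp : p a ≠ 0 := fun h => hq (hac a h)
    have hq' : 0 < (q a).toReal := ENNReal.toReal_pos hq (q.apply_ne_top a)
    have hp' : 0 < (p a).toReal := ENNReal.toReal_pos hp (p.apply_ne_top a)
    rw [hl, Real.exp_log (by positivity), ENNReal.ofReal_div_of_pos hp',
      ENNReal.ofReal_toReal (q.apply_ne_top a), ENNReal.ofReal_toReal (p.apply_ne_top a),
      ENNReal.div_mul_cancel hp (p.apply_ne_top a)]
  calc ∏ i, q (w i) ≤ ∏ i, (ENNReal.ofReal (Real.exp (l (w i))) * p (w i)) :=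
        Finset.prod_le_prod' fun i _ => hpt _
    _ = ENNReal.ofReal (Real.exp (∑ i, l (w i))) * ∏ i, p (w i) := by
        rw [Finset.prod_mul_distrib, Real.exp_sum,
          ENNReal.ofReal_prod_of_nonneg fun _ _ => (Real.exp_pos _).le]
    _ ≤ _ := by
        gcongr
        -- The log-likelihood ratio of a word depends only on its letter counts, and typicality
        -- fixes these up to `L * η` each.
        have e : ∑ i, l (w i) = ∑ a, letterCount ω L a * l a := by
          rw [← sum_range_eq_sum_letterCount, Finset.sum_range, ← hωw]
        rw [e, mul_add, Finset.mul_sum, Finset.mul_sum, Finset.mul_sum, ← Finset.sum_add_distrib]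
        refine Finset.sum_le_sum fun a _ => ?_
        have h1 : (letterCount ω L a - L * f a) * l a ≤ L * η * |l a| := by
          calc _ ≤ |(letterCount ω L a - L * f a) * l a| := le_abs_self _
            _ = |letterCount ω L a - L * f a| * |l a| := abs_mul _ _
            _ ≤ _ := by gcongr; exact hmem a
        simp only [hl, hf] at h1 ⊢
        linarith

end Tilt

/-! ### Flow balance: atypical demand forces a drop -/

namespace Policy

variable {N : Network m n} {K : ℕ}

theorem step_val (U : Policy N K) (x : State n K) (a : Fin m × Fin n) {i : Fin n}
    (h : U.assign x a.1 a.2 = some i) (l : Fin n) :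
    ((U.step x a).1 l : ℝ) = x.1 l + ((if a.2 = l then 1 else 0) - if i = l then 1 else 0) := by
  have hx : 0 < x.1 i := (U.feasible x a.1 a.2 i h).2
  have hs : (U.step x a).1 = move x.1 i a.2 := by
    unfold step
    split
    · rename_i h'; rw [h] at h'; cases h'
    · rename_i i' h'; rw [h] at h'; cases h'; rfl
  rw [hs]
  by_cases h1 : i = l
  · subst h1
    have h2 : ((x.1 i - 1 : ℕ) : ℝ) = x.1 i - 1 := by rw [Nat.cast_sub hx]; simp
    by_cases h3 : a.2 = i
    · simp [move, h3, h2]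
    · simp [move, h3, h2, Ne.symm h3]; ring
  · by_cases h3 : a.2 = l
    · simp [move, h3, h1, Ne.symm h1]
    · simp [move, h3, h1, Ne.symm h1, Ne.symm h3]

theorem traj_val (U : Policy N K) (x₀ : State n K) (ω : ℕ → Fin m × Fin n) (T : ℕ)
    (h : ∀ t < T, U.assign (U.traj x₀ ω t) (ω t).1 (ω t).2 ≠ none) (l : Fin n) :
    ((U.traj x₀ ω T).1 l : ℝ) = x₀.1 l + ((∑ t ∈ Finset.range T, if (ω t).2 = l then (1 : ℝ) else 0)
      - ∑ t ∈ Finset.range T,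
        if U.assign (U.traj x₀ ω t) (ω t).1 (ω t).2 = some l then (1 : ℝ) else 0) := by
  induction T with
  | zero => simp [traj]
  | succ T ih =>
    obtain ⟨i, hi⟩ := Option.ne_none_iff_exists'.1 (h T (Nat.lt_succ_self T))
    rw [traj, U.step_val _ _ hi, ih fun t ht => h t (ht.trans (Nat.lt_succ_self T)),
      Finset.sum_range_succ, Finset.sum_range_succ, hi]
    simp only [Option.some.injEq]
    ring

end Policy

theorem exists_le_of_le_lyapunov [Nonempty (Fin n)] {α Δ : Fin n → ℝ} (hα : ∀ i, 0 < α i) {v : ℝ}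
    (h : v ≤ lyapunov α (α + Δ)) : ∃ i, Δ i ≤ -v * α i := by
  obtain ⟨i, hi⟩ := exists_eq_ciInf_of_finite (f := fun i => (α + Δ) i / α i)
  refine ⟨i, ?_⟩
  rw [lyapunov, ← hi, Pi.add_apply, add_div, div_self (hα i).ne'] at h
  have : Δ i / α i ≤ -v := by linarith
  rwa [div_le_iff₀ (hα i)] at this

namespace Policy

variable {N : Network m n} {K : ℕ}

/-- If the empirical demand is close to `f`, some demand is dropped before the Lyapunov function
leaves its range. -/
theorem dropCount_pos_of_mem_typicalSet [Nonempty (Fin n)] (U : Policy N K)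
    (hsup : ∀ j, (N.suppliers j).Nonempty)
    {α : Fin n → ℝ} (hα : ∀ i, 0 < α i) {f : Fin m → Fin n → ℝ} {v v' η R : ℝ}
    (hv : (v : EReal) ≤ N.growthRate α f) (hη : ∀ i, η * (m + m * n) ≤ (v - v') * α i)
    {x : State n K} (hx : ∀ i, (x.1 i : ℝ) < R * α i) {L : ℕ} (hL : R ≤ L * v')
    {ω : ℕ → Fin m × Fin n} (hω : ω ∈ typicalSet (fun a => f a.1 a.2) η L) :
    0 < U.dropCount x ω L := by
  by_contra hcon
  have hzero : U.dropCount x ω L = 0 := by omega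
  have hserve : ∀ t < L, U.assign (U.traj x ω t) (ω t).1 (ω t).2 ≠ none := by
    intro t ht hnone
    have := (Finset.sum_eq_zero_iff.1 hzero) t (Finset.mem_range.2 ht)
    simp [hnone] at this
  set c : Fin m → Fin n → ℝ := fun j k => letterCount ω L (j, k) with hc
  set g : ℕ → Option (Fin n) := fun t => U.assign (U.traj x ω t) (ω t).1 (ω t).2 with hg
  set s : Fin n → Fin m → ℝ := fun i j =>
    ∑ t ∈ Finset.range L, if (ω t).1 = j ∧ g t = some i then (1 : ℝ) else 0 with hs
  have hs0 : ∀ i j, 0 ≤ s i j := fun i j => Finset.sum_nonneg fun t _ => by split_ifs <;> norm_num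
  have hsout : ∀ i j, i ∉ N.suppliers j → s i j = 0 := by
    intro i j hij
    refine Finset.sum_eq_zero fun t _ => if_neg ?_
    rintro ⟨rfl, h2⟩
    exact hij (U.feasible _ _ _ _ h2).1
  have hcj : ∀ j, ∑ k, c j k = ∑ t ∈ Finset.range L, if (ω t).1 = j then (1 : ℝ) else 0 := by
    intro j
    have h := sum_range_eq_sum_letterCount ω L fun a => if a.1 = j then (1 : ℝ) else 0
    rw [Fintype.sum_prod_type] at h
    simpa using h.symm
  have hci : ∀ i, ∑ j, c j i = ∑ t ∈ Finset.range L, if (ω t).2 = i then (1 : ℝ) else 0 := by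
    intro i
    have h := sum_range_eq_sum_letterCount ω L fun a => if a.2 = i then (1 : ℝ) else 0
    rw [Fintype.sum_prod_type] at h
    simpa using h.symm
  have hsj : ∀ j, ∑ i ∈ N.suppliers j, s i j = ∑ k, c j k := by
    intro j
    have h1 : ∑ i ∈ N.suppliers j, s i j = ∑ i, s i j :=
      Finset.sum_subset (Finset.subset_univ _) fun i _ hi => hsout i j hi
    rw [h1, hcj, Finset.sum_comm]
    refine Finset.sum_congr rfl fun t ht => ?_
    obtain ⟨i, hi⟩ := Option.ne_none_iff_exists'.1 (hserve t (Finset.mem_range.1 ht))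
    have hi' : g t = some i := hi
    simp only [hi', Option.some.injEq]
    by_cases h : (ω t).1 = j <;> simp [h]
  have hsi : ∀ i, ∑ j ∈ N.demands i, s i j
      = ∑ t ∈ Finset.range L, if g t = some i then (1 : ℝ) else 0 := by
    intro i
    have h1 : ∑ j ∈ N.demands i, s i j = ∑ j, s i j :=
      Finset.sum_subset (Finset.subset_univ _) fun j _ hj => hsout i j fun h => hj (by
        simpa [Network.suppliers, Network.demands] using h)
    rw [h1, Finset.sum_comm]
    refine Finset.sum_congr rfl fun t _ => ?_
    by_cases h : g t = some i <;> simp [h]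
  have hcj0 : ∀ j, 0 ≤ ∑ k, c j k := fun j => by
    rw [← hsj]; exact Finset.sum_nonneg fun i _ => hs0 i j
  -- Empirical routing fractions of the policy. Where no demand arrived, the uniform default keeps
  -- the fractions summing to 1 and the products `d i j * ∑ k, c j k` unchanged.
  set d : Fin n → Fin m → ℝ := fun i j =>
    if ∑ k, c j k = 0 then ((N.suppliers j).card : ℝ)⁻¹ else s i j / ∑ k, c j k with hd
  have hd0 : ∀ i j, 0 ≤ d i j := by
    intro i j
    simp only [hd]
    split_ifs
    · positivity
    · exact div_nonneg (hs0 i j) (hcj0 j)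
  have hd1 : ∀ j, ∑ i ∈ N.suppliers j, d i j = 1 := by
    intro j
    simp only [hd]
    split_ifs with h
    · have : ((N.suppliers j).card : ℝ) ≠ 0 := by exact_mod_cast (hsup j).card_pos.ne'
      simp [this]
    · rw [← Finset.sum_div, hsj, div_self h]
  have hdle : ∀ i j, i ∈ N.suppliers j → d i j ≤ 1 := fun i j hij =>
    (hd1 j) ▸ Finset.single_le_sum (f := fun i => d i j) (fun i _ => hd0 i j) hij
  have hsd : ∀ i j, i ∈ N.suppliers j → s i j = d i j * ∑ k, c j k := by
    intro i j hij
    simp only [hd]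
    split_ifs with h
    · rw [h, mul_zero]
      have h2 := hsj j
      rw [h] at h2
      exact (Finset.sum_eq_zero_iff_of_nonneg fun i _ => hs0 i j).1 h2 i hij
    · rw [div_mul_cancel₀ _ h]
  -- Same routing fractions, but with the empirical counts replaced by the ideal rates `f`: this
  -- makes the change attainable.
  set Δ : Fin n → ℝ := fun i => (∑ j, f j i) - ∑ j ∈ N.demands i, d i j * (∑ k, f j k) with hΔ
  have hmem : Δ ∈ N.attainable f := ⟨d, fun i => rfl, hd1, hd0⟩
  have hlyap : v ≤ lyapunov α (α + Δ) := by
    have := hv.trans (iInf₂_le (f := fun Δ (_ : Δ ∈ N.attainable f) =>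
      ((lyapunov α (α + Δ) : ℝ) : EReal)) Δ hmem)
    exact_mod_cast this
  obtain ⟨i, hi⟩ := exists_le_of_le_lyapunov hα hlyap
  have hval := U.traj_val x ω L hserve i
  rw [← hci, ← hsi] at hval
  have hnn : (0 : ℝ) ≤ ((U.traj x ω L).1 i : ℝ) := Nat.cast_nonneg _
  have hdem : ∀ j ∈ N.demands i, i ∈ N.suppliers j := fun j hj => by
    simpa [Network.suppliers, Network.demands] using hj
  have hLη : ∀ j k, |c j k - L * f j k| ≤ L * η := fun j k => hω (j, k)
  have hsum1 : ∑ j, c j i ≤ L * ∑ j, f j i + m * (L * η) := by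
    have : ∑ j, (c j i - L * f j i) ≤ ∑ _j : Fin m, L * η :=
      Finset.sum_le_sum fun j _ => (le_abs_self _).trans (hLη j i)
    rw [Finset.sum_sub_distrib, ← Finset.mul_sum] at this
    simp only [Finset.sum_const, Finset.card_univ, Fintype.card_fin, nsmul_eq_mul] at this
    linarith
  have hsum2 : L * ∑ j ∈ N.demands i, d i j * (∑ k, f j k) - ∑ j ∈ N.demands i, s i j
      ≤ m * (n * (L * η)) := by
    rcases Nat.eq_zero_or_pos m with rfl | hm
    · simp [Finset.eq_empty_of_isEmpty (N.demands i)]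
    have hLη0 : 0 ≤ L * η := (abs_nonneg _).trans (hLη ⟨0, hm⟩ i)
    rw [Finset.mul_sum, ← Finset.sum_sub_distrib]
    calc ∑ j ∈ N.demands i, (L * (d i j * ∑ k, f j k) - s i j)
        ≤ ∑ j ∈ N.demands i, (n * (L * η)) := by
          refine Finset.sum_le_sum fun j hj => ?_
          have hij := hdem j hj
          rw [hsd i j hij]
          have h1 : L * ∑ k, f j k - ∑ k, c j k ≤ n * (L * η) := by
            have : ∑ k, (L * f j k - c j k) ≤ ∑ _k : Fin n, L * η :=
              Finset.sum_le_sum fun k _ => by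
                have := (neg_abs_le _).trans' (neg_le_neg (hLη j k))
                linarith
            rw [Finset.sum_sub_distrib, ← Finset.mul_sum] at this
            simpa using this
          calc L * (d i j * ∑ k, f j k) - d i j * ∑ k, c j k
              = d i j * (L * ∑ k, f j k - ∑ k, c j k) := by ring
            _ ≤ d i j * (n * (L * η)) := mul_le_mul_of_nonneg_left h1 (hd0 i j)
            _ ≤ 1 * (n * (L * η)) := by gcongr; exact hdle i j hij
            _ = _ := one_mul _
      _ ≤ ∑ j : Fin m, (n * (L * η)) :=
          Finset.sum_le_sum_of_subset_of_nonneg (Finset.subset_univ _)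
            fun _ _ _ => by positivity
      _ = _ := by simp
  -- The drift loses at least `L * v * α i`, the deviation from `f` returns at most `L * (v - v') *
  -- α i`, and fewer than `L * v' * α i` units were present: the final count at `i` would be
  -- negative.
  have hLΔ : L * Δ i ≤ L * (-v * α i) := mul_le_mul_of_nonneg_left hi (Nat.cast_nonneg _)
  have hLη' : L * (η * (m + m * n)) ≤ L * ((v - v') * α i) :=
    mul_le_mul_of_nonneg_left (hη i) (Nat.cast_nonneg _)
  have hR : R * α i ≤ L * v' * α i := mul_le_mul_of_nonneg_right hL (hα i).le
  have hxi := hx i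
  simp only [hΔ, mul_sub] at hLΔ
  linarith

end Policy

/-! ### From drop probabilities to the exponent -/

theorem tendsto_neg_sub_log_div (s c : ℝ) (hc : 0 < c) :
    Tendsto (fun K : ℕ => (-(s * K) - Real.log (c * K)) / K) atTop (nhds (-s)) := by
  have h1 : Tendsto (fun x : ℝ => Real.log x / x) atTop (nhds 0) := by
    simpa using Real.tendsto_pow_log_div_mul_add_atTop 1 0 1 one_ne_zero
  have h2 : Tendsto (fun K : ℕ => Real.log (c * K) / (c * K)) atTop (nhds 0) :=
    h1.comp (tendsto_natCast_atTop_atTop.const_mul_atTop hc)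
  have h3 := (h2.const_mul c).const_sub (-s)
  rw [mul_zero, sub_zero] at h3
  refine h3.congr' ?_
  filter_upwards [eventually_gt_atTop 0] with K hK
  have : (K : ℝ) ≠ 0 := by exact_mod_cast hK.ne'
  field_simp

/-- A uniform lower bound on the probability of a drop in a time window linear in the number of
units bounds the exponent. -/
theorem optimisticExponent_le {N : Network m n} [Nonempty (Fin m × Fin n)] (U : ∀ K, Policy N K)
    {s : ℝ} (hs : 0 ≤ s) {τ : ℕ} (hτ : 0 < τ)
    (h : ∀ᶠ K : ℕ in atTop, ∀ x : State n K, ENNReal.ofReal (Real.exp (-(s * K))) ≤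
      N.arrivalLaw {ω | 0 < (U K).dropCount x ω (τ * K)}) :
    optimisticExponent U ≤ s := by
  rw [optimisticExponent, EReal.neg_le]
  have ht := tendsto_neg_sub_log_div s (8 * τ) (by positivity)
  have ht' : Tendsto (fun K : ℕ => (((-(s * K) - Real.log (8 * τ * K)) / K : ℝ) : EReal)) atTop
      (nhds ((-s : ℝ) : EReal)) := (continuous_coe_real_ereal.tendsto _).comp ht
  rw [← EReal.coe_neg, ← ht'.liminf_eq]
  refine liminf_le_liminf ?_
  filter_upwards [h, eventually_gt_atTop 0] with K hK hK0
  have hK0' : (0 : ℝ) < K := by exact_mod_cast hK0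
  -- Blocks have length `τ * K` and `p = exp (-(s * K))`; the denominator `8 * τ * K` vanishes on
  -- the scale `1 / K * log`.
  have hτ' : (0 : ℝ) < τ := by exact_mod_cast hτ
  have hle := (U K).le_optimisticDropProb (Nat.mul_pos hτ hK0) (Real.exp_pos _)
    (Real.exp_le_one_iff.2 (by nlinarith)) hK
  have hlog := ENNReal.log_le_log hle
  rw [ENNReal.log_ofReal_of_pos (by positivity), Real.log_div (Real.exp_pos _).ne' (by positivity),
    Real.log_exp] at hlog
  rw [EReal.coe_div]
  refine EReal.div_le_div_right_of_nonneg (by exact_mod_cast hK0'.le) ?_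
  convert hlog using 4
  push_cast
  ring

/-! ### Bounds on the converse bound -/

namespace Network

/-- Gibbs' inequality, from `log t ≤ t - 1` at `t = φ / f`. -/
theorem sum_mul_log_nonneg (N : Network m n) {f : Fin m → Fin n → ℝ} (hf : ∀ j k, 0 ≤ f j k)
    (hsum : ∑ j, ∑ k, f j k = 1) (hac : ∀ j k, N.φ j k = 0 → f j k = 0) :
    0 ≤ ∑ j, ∑ k, f j k * Real.log (f j k / N.φ j k) := by
  have h : ∑ j, ∑ k, (f j k - N.φ j k) ≤ ∑ j, ∑ k, f j k * Real.log (f j k / N.φ j k) := by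
    refine Finset.sum_le_sum fun j _ => Finset.sum_le_sum fun k _ => ?_
    rcases (hf j k).eq_or_lt with h0 | h0
    · rw [← h0]; simp [N.φ_nonneg j k]
    have hφ : 0 < N.φ j k := (N.φ_nonneg j k).lt_of_ne fun h => h0.ne' (hac j k h.symm)
    have h1 := Real.log_le_sub_one_of_pos (div_pos hφ h0)
    have h2 : Real.log (f j k / N.φ j k) = -Real.log (N.φ j k / f j k) := by
      rw [← Real.log_inv, inv_div]
    rw [h2]
    have h3 := mul_le_mul_of_nonneg_left h1 h0.le
    rw [mul_sub, mul_div_cancel₀ _ h0.ne'] at h3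
    linarith
  refine le_trans (le_of_eq ?_) h
  simp only [Finset.sum_sub_distrib]
  rw [hsum, N.φ_sum, sub_self]

theorem rate_nonneg (N : Network m n) (f : Fin m → Fin n → ℝ) : 0 ≤ N.rate f := by
  unfold rate klDivergence
  split_ifs with h1 h2
  · exact_mod_cast N.sum_mul_log_nonneg h1.1 h1.2 h2
  · exact le_top
  · exact le_top

theorem converseBound_nonneg (N : Network m n) (α : Fin n → ℝ) : 0 ≤ N.converseBound α :=
  le_iInf₂ fun f hf => EReal.div_nonneg (N.rate_nonneg f) hf.le

theorem attainable_nonempty (N : Network m n) (hsup : ∀ j, (N.suppliers j).Nonempty)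
    (f : Fin m → Fin n → ℝ) : (N.attainable f).Nonempty := by
  refine ⟨_, fun _ j => ((N.suppliers j).card : ℝ)⁻¹, fun i => rfl, fun j => ?_, fun i j => ?_⟩
  · have : ((N.suppliers j).card : ℝ) ≠ 0 := by exact_mod_cast (hsup j).card_pos.ne'
    simp [this]
  · positivity

theorem φ_le_one (N : Network m n) (j : Fin m) (k : Fin n) : N.φ j k ≤ 1 := by
  rw [← N.φ_sum]
  exact (Finset.single_le_sum (f := fun k => N.φ j k) (fun k _ => N.φ_nonneg j k)
    (Finset.mem_univ k)).trans (Finset.single_le_sum (f := fun j => ∑ k, N.φ j k)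
      (fun j _ => Finset.sum_nonneg fun k _ => N.φ_nonneg j k) (Finset.mem_univ j))

/-- The point mass at a demand type. -/
def pointMass (j : Fin m) (k : Fin n) : Fin m → Fin n → ℝ := Pi.single j (Pi.single k 1)

theorem pointMass_apply (j j' : Fin m) (k k' : Fin n) :
    pointMass j k j' k' = if j' = j then if k' = k then 1 else 0 else 0 := by
  unfold pointMass
  by_cases h : j' = j
  · subst h; simp [Pi.single_apply]
  · simp [h]

theorem rate_pointMass (N : Network m n) {j : Fin m} {k : Fin n} (h : 0 < N.φ j k) :
    N.rate (pointMass j k) = ((-Real.log (N.φ j k) : ℝ) : EReal) := by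
  have h1 : (∀ j' k', (0 : ℝ) ≤ pointMass j k j' k') ∧ ∑ j', ∑ k', pointMass j k j' k' = 1 := by
    constructor
    · intro j' k'; rw [pointMass_apply]; split_ifs <;> norm_num
    · simp only [pointMass_apply]
      rw [Finset.sum_eq_single j] <;> simp +contextual
  have h2 : ∀ j' k', N.φ j' k' = 0 → pointMass j k j' k' = 0 := by
    intro j' k' h0
    rw [pointMass_apply]
    split_ifs with hj hk
    · subst hj; subst hk; exact absurd h0 h.ne'
    · rfl
    · rfl
  rw [rate, if_pos h1, klDivergence, if_pos h2]
  congr 1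
  rw [Finset.sum_eq_single j, Finset.sum_eq_single k]
  · simp [pointMass_apply]
  · intro k' _ hk; simp [pointMass_apply, hk]
  · simp
  · intro j' _ hj; simp [pointMass_apply, hj]
  · simp

/-- The suppliers of `j` lose total mass 1 and regain none, since `k` is not among them. As `α` has
mass at most 1 there, some supplier `i` loses at least `α i`. -/
theorem one_le_growthRate_pointMass (N : Network m n) {j : Fin m} {k : Fin n}
    (hk : k ∉ N.suppliers j) {α : Fin n → ℝ} (hα : ∀ i, 0 < α i) (hsum : ∑ i, α i = 1) :
    1 ≤ N.growthRate α (pointMass j k) := by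
  refine le_iInf₂ fun Δ hΔ => ?_
  obtain ⟨d, hd, hd1, hd0⟩ := hΔ
  have hsne : (N.suppliers j).Nonempty := by
    by_contra h
    have := hd1 j
    rw [Finset.not_nonempty_iff_eq_empty.1 h] at this
    simp at this
  have hle : ∑ i ∈ N.suppliers j, α i ≤ ∑ i ∈ N.suppliers j, d i j := by
    rw [hd1, ← hsum]
    exact Finset.sum_le_sum_of_subset_of_nonneg (Finset.subset_univ _) fun i _ _ => (hα i).le
  obtain ⟨i, hi, hαd⟩ := Finset.exists_le_of_sum_le hsne hle
  have hΔi : Δ i = -d i j := by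
    have hik : i ≠ k := fun h => hk (h ▸ hi)
    have hj : j ∈ N.demands i := by simpa [suppliers, demands] using hi
    have e1 : ∑ j', pointMass j k j' i = 0 :=
      Finset.sum_eq_zero fun j' _ => by simp [pointMass_apply, hik]
    have e2 : ∑ j' ∈ N.demands i, d i j' * ∑ k', pointMass j k j' k' = d i j := by
      rw [Finset.sum_eq_single j]
      · simp [pointMass_apply]
      · intro j' _ hj'; simp [pointMass_apply, hj']
      · exact fun h => absurd hj h
    rw [hd, e1, e2, zero_sub]
  have hinf : ⨅ i, (α + Δ) i / α i ≤ (α + Δ) i / α i := ciInf_le (Set.finite_range _).bddBelow i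
  have hneg : (α + Δ) i / α i ≤ 0 :=
    div_nonpos_of_nonpos_of_nonneg (by rw [Pi.add_apply, hΔi]; linarith) (hα i).le
  have : (1 : ℝ) ≤ lyapunov α (α + Δ) := by
    unfold lyapunov; linarith
  exact_mod_cast this

/-- The bound does not depend on `α`, which allows `δ` to be fixed before `α`. This is where
non-triviality enters. -/
theorem converseBound_le (N : Network m n) {j : Fin m} {k : Fin n} (hk : k ∉ N.suppliers j)
    (hφ : 0 < N.φ j k) {α : Fin n → ℝ} (hα : ∀ i, 0 < α i) (hsum : ∑ i, α i = 1) :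
    N.converseBound α ≤ ((-Real.log (N.φ j k) : ℝ) : EReal) := by
  have hg := N.one_le_growthRate_pointMass hk hα hsum
  have hg0 : 0 < N.growthRate α (pointMass j k) := lt_of_lt_of_le zero_lt_one hg
  have hlog : 0 ≤ -Real.log (N.φ j k) := by
    linarith [Real.log_nonpos hφ.le (N.φ_le_one j k)]
  refine (iInf₂_le (pointMass j k) hg0).trans ?_
  rw [N.rate_pointMass hφ]
  by_cases htop : N.growthRate α (pointMass j k) = ⊤
  · rw [htop, EReal.div_top]
    exact_mod_cast hlog
  · rw [EReal.div_le_iff_le_mul hg0 htop]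
    lift N.growthRate α (pointMass j k) to ℝ using
      ⟨htop, (EReal.bot_lt_zero.trans hg0).ne'⟩ with g
    have hg' : (1 : ℝ) ≤ g := by exact_mod_cast hg
    have : -Real.log (N.φ j k) ≤ g * -Real.log (N.φ j k) := le_mul_of_one_le_left hlog hg'
    exact_mod_cast this

end Network

/-- On the affine span the coordinates still sum to 1, so positivity of all coordinates is an open
condition that implies membership in the simplex. -/
theorem mem_simplexInterior {α : Fin n → ℝ} (hα : ∀ i, 0 < α i) (hsum : ∑ i, α i = 1) :
    α ∈ simplexInterior n := by
  have hmem : α ∈ stdSimplex ℝ (Fin n) := ⟨fun i => (hα i).le, hsum⟩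
  have hspan : ∀ y ∈ affineSpan ℝ (stdSimplex ℝ (Fin n)), ∑ i, y i = 1 := by
    intro y hy
    refine affineSpan_induction (p := fun y : Fin n → ℝ => ∑ i, y i = 1) hy (fun x hx => hx.2) ?_
    intro c u v w hu hv hw
    simp only [vsub_eq_sub, vadd_eq_add, Pi.add_apply, Pi.smul_apply, Pi.sub_apply, smul_eq_mul,
      Finset.sum_add_distrib, ← Finset.mul_sum, Finset.sum_sub_distrib, hu, hv, hw]
    ring
  rw [simplexInterior, mem_intrinsicInterior]
  refine ⟨⟨α, subset_affineSpan ℝ _ hmem⟩, ?_, rfl⟩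
  rw [mem_interior]
  refine ⟨{y | ∀ i, 0 < (y : Fin n → ℝ) i}, fun y hy => ⟨fun i => (hy i).le, hspan y y.2⟩, ?_, hα⟩
  simp only [Set.ofPred_forall]
  exact isOpen_iInter_of_finite fun i =>
    isOpen_lt continuous_const ((continuous_apply i).comp continuous_subtype_val)

/-! ### Drop probability from states near `α` -/

namespace Network

/-- The demand rates `f` force a drop within linear time, at a cost governed by the divergence of
`f` and the growth rate of the Lyapunov function. -/
theorem exists_window_of_growthRate [Nonempty (Fin m × Fin n)] (N : Network m n)
    (hsup : ∀ j, (N.suppliers j).Nonempty) {α : Fin n → ℝ} (hα : ∀ i, 0 < α i)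
    {f : Fin m → Fin n → ℝ} (hf : ∀ j k, 0 ≤ f j k) (hsum : ∑ j, ∑ k, f j k = 1)
    (hac : ∀ j k, N.φ j k = 0 → f j k = 0) {v : ℝ} (hv0 : 0 < v)
    (hv : (v : EReal) ≤ N.growthRate α f) {δ s : ℝ} (hδ : 0 < δ)
    (hs : (1 + δ) * (∑ j, ∑ k, f j k * Real.log (f j k / N.φ j k)) / v < s) :
    ∃ τ : ℕ, 0 < τ ∧ ∀ᶠ K : ℕ in atTop, ∀ (U : Policy N K) (x : State n K),
      (∀ i, (x.1 i : ℝ) < (1 + δ) * K * α i) →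
      ENNReal.ofReal (Real.exp (-(s * K))) ≤ N.arrivalLaw {ω | 0 < U.dropCount x ω (τ * K)} := by
  have : Nonempty (Fin n) := (inferInstance : Nonempty (Fin m × Fin n)).map Prod.snd
  set D := ∑ j, ∑ k, f j k * Real.log (f j k / N.φ j k) with hD
  have hD0 : 0 ≤ D := N.sum_mul_log_nonneg hf hsum hac
  set M := ∑ a : Fin m × Fin n, |Real.log (f a.1 a.2 / N.φ a.1 a.2)| with hM
  have hM0 : 0 ≤ M := Finset.sum_nonneg fun _ _ => abs_nonneg _
  set C := ∑ i, ((m : ℝ) + m * n) / α i with hC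
  have hCα : ∀ i, (m : ℝ) + m * n ≤ C * α i := fun i => by
    rw [← div_le_iff₀ (hα i)]
    exact Finset.single_le_sum (f := fun i => ((m : ℝ) + m * n) / α i)
      (fun i _ => div_nonneg (by positivity) (hα i).le) (Finset.mem_univ i)
  -- The strict inequality `hs` is the case `η = 0`; continuity extends it to small positive `η`.
  obtain ⟨η, hη, hv', hηs⟩ : ∃ η : ℝ, 0 < η ∧ 0 < v - C * η ∧
      (1 + δ) * (D + η * M) / (v - C * η) < s := by
    have h1 : Tendsto (fun η : ℝ => v - C * η) (nhds 0) (nhds v) := by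
      have : Continuous fun η : ℝ => v - C * η := by fun_prop
      simpa using this.tendsto 0
    have h2 : Tendsto (fun η : ℝ => (1 + δ) * (D + η * M)) (nhds 0) (nhds ((1 + δ) * D)) := by
      have : Continuous fun η : ℝ => (1 + δ) * (D + η * M) := by fun_prop
      simpa using this.tendsto 0
    have h3 := (h2.div h1 hv0.ne').eventually_lt_const hs
    have h4 := h1.eventually_const_lt hv0
    have h5 := (eventually_mem_nhdsWithin : ∀ᶠ η : ℝ in nhdsWithin 0 (Set.Ioi 0), η ∈ Set.Ioi 0)
    obtain ⟨η, h, h'⟩ := (h5.and ((h4.and h3).filter_mono nhdsWithin_le_nhds)).exists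
    exact ⟨η, h, h'.1, h'.2⟩
  set v' := v - C * η with hv'def
  set r := (1 + δ) / v' with hr
  have hr0 : 0 < r := by positivity
  set H := D + η * M with hH
  have hH0 : 0 ≤ H := by positivity
  have hrH : r * H < s := by
    rw [hr, div_mul_eq_mul_div]; exact hηs
  let q : PMF (Fin m × Fin n) := PMF.ofFintype (fun a => ENNReal.ofReal (f a.1 a.2)) (by
    rw [← ENNReal.ofReal_sum_of_nonneg (fun a _ => hf a.1 a.2), Fintype.sum_prod_type, hsum,
      ENNReal.ofReal_one])
  have hq : ∀ a, (q a).toReal = f a.1 a.2 := fun a => by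
    simp [q, ENNReal.toReal_ofReal (hf a.1 a.2)]
  have hp : ∀ a, (N.arrivalPMF a).toReal = N.φ a.1 a.2 := fun a => by
    simp [arrivalPMF, ENNReal.toReal_ofReal (N.φ_nonneg a.1 a.2)]
  have hpq : ∀ a, N.arrivalPMF a = 0 → q a = 0 := by
    intro a ha
    have h0 : N.φ a.1 a.2 = 0 := by rw [← hp, ha, ENNReal.toReal_zero]
    simp [q, hac _ _ h0]
  have hceil : Tendsto (fun K : ℕ => ⌈r * K⌉₊) atTop atTop :=
    tendsto_nat_ceil_atTop.comp (tendsto_natCast_atTop_atTop.const_mul_atTop hr0)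
  -- The slack `s - r * H` absorbs the factor `1 / 2` of the typical set and the rounding of `r * K`
  -- up to an integer.
  have hlin : ∀ᶠ K : ℕ in atTop, Real.log 2 + H ≤ (s - r * H) * K :=
    (tendsto_natCast_atTop_atTop.const_mul_atTop (sub_pos.2 hrH)).eventually_ge_atTop _
  refine ⟨⌈r⌉₊, Nat.ceil_pos.2 hr0, ?_⟩
  filter_upwards [hceil.eventually (eventually_half_le_typicalSet q hη), hlin] with K hK hKlin U x hx
  set L := ⌈r * K⌉₊ with hL
  have hLr : r * K ≤ L := Nat.le_ceil _
  have hLr' : (L : ℝ) ≤ r * K + 1 := (Nat.ceil_lt_add_one (by positivity)).le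
  have hLτ : L ≤ ⌈r⌉₊ * K := by
    refine Nat.ceil_le.2 ?_
    push_cast
    gcongr
    exact Nat.le_ceil r
  have htilt := iidLaw_typicalSet_le N.arrivalPMF q hpq η L
  simp only [hq, hp] at htilt hK
  have hDsum : ∑ a : Fin m × Fin n, f a.1 a.2 * Real.log (f a.1 a.2 / N.φ a.1 a.2) = D := by
    rw [Fintype.sum_prod_type]
  rw [hDsum] at htilt
  have hsub : typicalSet (fun a : Fin m × Fin n => f a.1 a.2) η L ⊆
      {ω | 0 < U.dropCount x ω (⌈r⌉₊ * K)} := by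
    intro ω hω
    refine lt_of_lt_of_le ?_ (U.dropCount_mono x ω hLτ)
    refine U.dropCount_pos_of_mem_typicalSet hsup hα (v' := v') hv (fun i => ?_) hx ?_ hω
    · have := mul_le_mul_of_nonneg_left (hCα i) hη.le
      rw [hv'def]; linarith
    · rw [hr, div_mul_eq_mul_div, div_le_iff₀ hv'] at hLr
      exact hLr
  refine le_trans ?_ (measure_mono hsub)
  have hexp : ENNReal.ofReal (Real.exp (L * H)) ≠ 0 := by simp [Real.exp_pos]
  rw [← ENNReal.mul_le_mul_iff_right hexp ENNReal.ofReal_ne_top]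
  refine le_trans ?_ (hK.trans htilt)
  rw [← ENNReal.ofReal_mul (Real.exp_pos _).le, ← Real.exp_add]
  have e : (1 / 2 : ℝ≥0∞) = ENNReal.ofReal (1 / 2) := by
    rw [ENNReal.ofReal_div_of_pos (by norm_num)]; simp
  rw [e]
  refine ENNReal.ofReal_le_ofReal ?_
  have h2 : (1 / 2 : ℝ) = Real.exp (-Real.log 2) := by
    rw [Real.exp_neg, Real.exp_log (by norm_num), one_div]
  rw [h2]
  refine Real.exp_le_exp.2 ?_
  have := mul_le_mul_of_nonneg_right hLr' hH0
  linarith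

/-- Up to `ε`, the converse bound of `α` is the rate at which drops occur from states close
to `α`. -/
theorem exists_window_of_converseBound [Nonempty (Fin m × Fin n)] (N : Network m n)
    (hsup : ∀ j, (N.suppliers j).Nonempty) {α : Fin n → ℝ} (hα : ∀ i, 0 < α i) {C ε δ : ℝ}
    (hC : N.converseBound α ≤ C) (hε : 0 < ε) (hδ : 0 < δ) (hδε : δ * (C + ε) ≤ ε / 2) :
    ∃ s : ℝ, 0 ≤ s ∧ (s : EReal) ≤ N.converseBound α + (ε : EReal) ∧ ∃ τ : ℕ, 0 < τ ∧
      ∀ᶠ K : ℕ in atTop, ∀ (U : Policy N K) (x : State n K),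
      (∀ i, (x.1 i : ℝ) < (1 + δ) * K * α i) →
      ENNReal.ofReal (Real.exp (-(s * K))) ≤ N.arrivalLaw {ω | 0 < U.dropCount x ω (τ * K)} := by
  have h0 := N.converseBound_nonneg α
  obtain ⟨b, hb⟩ : ∃ b : ℝ, N.converseBound α = b := by
    refine ⟨(N.converseBound α).toReal, (EReal.coe_toReal ?_ ?_).symm⟩
    · exact (hC.trans_lt (EReal.coe_lt_top C)).ne
    · exact (EReal.bot_lt_zero.trans_le h0).ne'
  rw [hb] at hC h0
  have hb0 : 0 ≤ b := by exact_mod_cast h0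
  have hbC : b ≤ C := by exact_mod_cast hC
  have hlt : N.converseBound α < ((b + ε / 2 : ℝ) : EReal) := by
    rw [hb]; exact_mod_cast (by linarith : b < b + ε / 2)
  simp only [converseBound, iInf_lt_iff] at hlt
  obtain ⟨f, hpos, hlt⟩ := hlt
  obtain ⟨Δ, hΔ⟩ := N.attainable_nonempty hsup f
  have htop : N.growthRate α f ≠ ⊤ :=
    ((iInf₂_le (f := fun Δ (_ : Δ ∈ N.attainable f) => ((lyapunov α (α + Δ) : ℝ) : EReal))
      Δ hΔ).trans_lt (EReal.coe_lt_top _)).ne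
  obtain ⟨v, hv⟩ : ∃ v : ℝ, N.growthRate α f = v :=
    ⟨_, (EReal.coe_toReal htop (EReal.bot_lt_zero.trans hpos).ne').symm⟩
  rw [hv] at hlt hpos
  have hv0 : 0 < v := by exact_mod_cast hpos
  rw [EReal.div_lt_iff hpos (EReal.coe_ne_top v)] at hlt
  have hrate : N.rate f ≠ ⊤ := by
    rw [← EReal.coe_mul] at hlt
    exact (hlt.trans (EReal.coe_lt_top _)).ne
  have hcond : (∀ j k, 0 ≤ f j k) ∧ ∑ j, ∑ k, f j k = 1 := by
    by_contra h
    exact hrate (by rw [rate, if_neg h])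
  have hac : ∀ j k, N.φ j k = 0 → f j k = 0 := by
    by_contra h
    exact hrate (by rw [rate, if_pos hcond, klDivergence, if_neg h])
  rw [rate, if_pos hcond, klDivergence, if_pos hac] at hlt
  set D := ∑ j, ∑ k, f j k * Real.log (f j k / N.φ j k)
  have hlt' : D < (b + ε / 2) * v := by exact_mod_cast hlt
  have hDv : D / v < b + ε / 2 := by rwa [div_lt_iff₀ hv0]
  -- Half of `ε` pays for a near-optimal `f`, the other half for the factor `1 + δ`.
  refine ⟨b + ε, by positivity, by rw [hb]; push_cast; exact le_rfl,
    N.exists_window_of_growthRate hsup hα hcond.1 hcond.2 hac hv0 hv.ge hδ ?_⟩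
  rw [mul_div_assoc]
  calc (1 + δ) * (D / v) < (1 + δ) * (b + ε / 2) := by gcongr
    _ = b + ε / 2 + δ * (b + ε / 2) := by ring
    _ ≤ b + ε / 2 + δ * (C + ε) := by gcongr; linarith
    _ ≤ b + ε := by linarith

theorem measure_first_arrival (N : Network m n) (a : Fin m × Fin n) :
    N.arrivalLaw {ω | ω 0 = a} = ENNReal.ofReal (N.φ a.1 a.2) := by
  have h : N.arrivalLaw.map (fun ω => ω 0) = N.arrivalPMF.toMeasure :=
    Measure.infinitePi_map_eval (fun _ : ℕ => N.arrivalPMF.toMeasure) 0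
  have h2 : N.arrivalLaw {ω | ω 0 = a} = N.arrivalLaw.map (fun ω => ω 0) {a} := by
    rw [Measure.map_apply (measurable_pi_apply 0) (measurableSet_singleton a)]
    rfl
  rw [h2, h, PMF.toMeasure_apply_singleton _ _ (measurableSet_singleton a)]
  simp [arrivalPMF]

end Network

/-! ### The degenerate case, compactness and the conclusion -/

/-- If some demand node has no compatible supply node, the drop probability does not vanish. -/
theorem optimisticExponent_le_of_suppliers_eq_empty {N : Network m n} (U : ∀ K, Policy N K)
    {j : Fin m} (hj : N.suppliers j = ∅) {ε : ℝ} (hε : 0 < ε) : optimisticExponent U ≤ ε := by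
  obtain ⟨k, -, hk⟩ := Finset.exists_lt_of_sum_lt (s := Finset.univ) (f := fun _ => (0 : ℝ))
    (g := N.φ j) (by simpa using N.φ_row_pos j)
  have : Nonempty (Fin m × Fin n) := ⟨(j, k)⟩
  refine optimisticExponent_le U hε.le one_pos ?_
  have ht : Tendsto (fun K : ℕ => Real.exp (-(ε * K))) atTop (nhds 0) :=
    Real.tendsto_exp_neg_atTop_nhds_zero.comp (tendsto_natCast_atTop_atTop.const_mul_atTop hε)
  filter_upwards [ht.eventually_lt_const hk, eventually_ge_atTop 1] with K hK hK1 x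
  calc ENNReal.ofReal (Real.exp (-(ε * K))) ≤ ENNReal.ofReal (N.φ j k) :=
        ENNReal.ofReal_le_ofReal hK.le
    _ = N.arrivalLaw {ω | ω 0 = (j, k)} := (N.measure_first_arrival (j, k)).symm
    _ ≤ _ := by
        refine measure_mono fun ω hω => ?_
        have hω' : ω 0 = (j, k) := hω
        refine lt_of_lt_of_le ?_ ((U K).dropCount_mono x ω (by simpa using hK1 : 1 ≤ 1 * K))
        have hnone : (U K).assign ((U K).traj x ω 0) (ω 0).1 (ω 0).2 = none := by
          rw [Option.eq_none_iff_forall_ne_some]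
          intro i hi
          have := ((U K).feasible _ _ _ _ hi).1
          rw [hω', hj] at this
          simp at this
        rw [Policy.dropCount, Finset.sum_range_one, if_pos hnone]
        exact one_pos

theorem exists_optimisticExponent_le_converseBound_add (N : Network m n) (hN : N.NonTrivial)
    (U : ∀ K, Policy N K) {ε : ℝ} (hε : 0 < ε) :
    ∃ α ∈ simplexInterior n, optimisticExponent U ≤ N.converseBound α + (ε : EReal) := by
  obtain ⟨j, k, hk, hφ⟩ := hN
  have : Nonempty (Fin m × Fin n) := ⟨(j, k)⟩
  have hn : (0 : ℝ) < n := by exact_mod_cast k.pos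
  by_cases hsup : ∀ j, (N.suppliers j).Nonempty
  swap
  · push Not at hsup
    obtain ⟨j', hj'⟩ := hsup
    refine ⟨fun _ => (n : ℝ)⁻¹, mem_simplexInterior (fun _ => by positivity)
      (by simp [hn.ne']), ?_⟩
    refine (optimisticExponent_le_of_suppliers_eq_empty U hj' hε).trans ?_
    exact le_add_of_nonneg_left (N.converseBound_nonneg _)
  set C := -Real.log (N.φ j k) with hC
  have hC0 : 0 ≤ C := by
    linarith [Real.log_nonpos hφ.le (N.φ_le_one j k)]
  set δ := ε / (2 * (C + ε)) with hδ
  have hδ0 : 0 < δ := by positivity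
  have hδε : δ * (C + ε) ≤ ε / 2 := by
    rw [hδ]; apply le_of_eq; field_simp
  -- Chosen so that `(1 + δ) * α x i = x i + δ / n`: `α x` is interior even for `x` on the boundary,
  -- and the states it handles form a neighbourhood of `x`.
  let α : (Fin n → ℝ) → Fin n → ℝ := fun x i => (x i + δ / n) / (1 + δ)
  have hα : ∀ x ∈ stdSimplex ℝ (Fin n), (∀ i, 0 < α x i) ∧ ∑ i, α x i = 1 := by
    intro x hx
    refine ⟨fun i => div_pos (add_pos_of_nonneg_of_pos (hx.1 i) (by positivity)) (by positivity), ?_⟩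
    simp only [α, ← Finset.sum_div, Finset.sum_add_distrib, hx.2, Finset.sum_const,
      Finset.card_univ, Fintype.card_fin, nsmul_eq_mul]
    field_simp
  have hwin : ∀ x ∈ stdSimplex ℝ (Fin n), _ := fun x hx =>
    N.exists_window_of_converseBound hsup (hα x hx).1
      (N.converseBound_le hk hφ (hα x hx).1 (hα x hx).2) hε hδ0 hδε
  choose! s hs0 hs τ hτ hev using hwin
  obtain ⟨t, hts, hcov⟩ := (isCompact_stdSimplex ℝ (Fin n)).elim_nhds_subcover
    (fun x => {y | ∀ i, y i < x i + δ / n}) fun x _ => by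
      refine IsOpen.mem_nhds ?_ fun i => lt_add_of_pos_right _ (by positivity)
      simp only [Set.ofPred_forall]
      exact isOpen_iInter_of_finite fun i => isOpen_lt (continuous_apply i) continuous_const
  have hcov' : ∀ y ∈ stdSimplex ℝ (Fin n), ∃ x ∈ t, ∀ i, y i < x i + δ / n := fun y hy => by
    simpa using hcov hy
  have htne : t.Nonempty := by
    obtain ⟨x, hx, -⟩ := hcov' (Pi.single k 1) (single_mem_stdSimplex ℝ k)
    exact ⟨x, hx⟩
  -- The weakest bound of the finite cover holds from every state; summing the `τ x` gives a common
  -- window, since drop counts are monotone in time.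
  obtain ⟨z, hz, hmax⟩ := t.exists_max_image s htne
  refine ⟨α z, mem_simplexInterior (hα z (hts z hz)).1 (hα z (hts z hz)).2,
    le_trans ?_ (hs z (hts z hz))⟩
  refine optimisticExponent_le U (hs0 z (hts z hz)) (τ := ∑ x ∈ t, τ x)
    (Finset.sum_pos (fun x hx => hτ x (hts x hx)) htne) ?_
  filter_upwards [(eventually_all_finset t).2 fun x hx => hev x (hts x hx),
    eventually_gt_atTop 0] with K hK hK0 y
  have hK0' : (0 : ℝ) < K := by exact_mod_cast hK0
  obtain ⟨x, hx, hyx⟩ := hcov' (fun i => (y.1 i : ℝ) / K) (by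
    refine ⟨fun i => by positivity, ?_⟩
    rw [← Finset.sum_div, ← Nat.cast_sum, y.2, div_self hK0'.ne'])
  have hdrop := hK x hx (U K) y fun i => by
    have h1 := hyx i
    rw [div_lt_iff₀ hK0'] at h1
    have h2 : (1 + δ) * K * α x i = (x i + δ / n) * K := by
      simp only [α]; field_simp
    rw [h2]; exact h1
  calc ENNReal.ofReal (Real.exp (-(s z * K))) ≤ ENNReal.ofReal (Real.exp (-(s x * K))) := by
        gcongr; exact hmax x hx
    _ ≤ _ := hdrop
    _ ≤ _ := by
        refine measure_mono fun ω hω => lt_of_lt_of_le hω ((U K).dropCount_mono y ω ?_)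
        gcongr
        exact Finset.single_le_sum (f := τ) (fun _ _ => Nat.zero_le _) hx

end RideHailing

theorem lemma2 {m n : ℕ} (N : RideHailing.Network m n) (hN : N.NonTrivial)
    (U : ∀ K, RideHailing.Policy N K) :
    (∀ ε : ℝ, 0 < ε → ∃ α ∈ RideHailing.simplexInterior n,
      RideHailing.optimisticExponent U ≤ N.converseBound α + (ε : EReal)) ∧
    RideHailing.optimisticExponent U ≤ ⨆ α ∈ RideHailing.simplexInterior n, N.converseBound α := by
  have key := fun (ε : ℝ) (hε : 0 < ε) =>
    RideHailing.exists_optimisticExponent_le_converseBound_add N hN U hε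
  -- Testing against real `z` above the supremum leaves only the case of a finite supremum.
  refine ⟨key, EReal.le_of_forall_lt_iff_le.1 fun z hz => ?_⟩
  set S := ⨆ α ∈ RideHailing.simplexInterior n, N.converseBound α with hS
  have hle : ∀ α ∈ RideHailing.simplexInterior n, N.converseBound α ≤ S := fun α hα =>
    le_iSup₂ (f := fun α (_ : α ∈ RideHailing.simplexInterior n) => N.converseBound α) α hα
  obtain ⟨α₁, hα₁, -⟩ := key 1 one_pos
  have hS0 : 0 ≤ S := (N.converseBound_nonneg α₁).trans (hle α₁ hα₁)
  lift S to ℝ using ⟨(hz.trans (EReal.coe_lt_top z)).ne, (EReal.bot_lt_zero.trans_le hS0).ne'⟩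
    with u
  have huz : u < z := by exact_mod_cast hz
  obtain ⟨α, hα, h⟩ := key (z - u) (sub_pos.2 huz)
  calc _ ≤ N.converseBound α + ((z - u : ℝ) : EReal) := h
    _ ≤ (u : EReal) + ((z - u : ℝ) : EReal) := by gcongr; exact hle α hα
    _ = z := by rw [← EReal.coe_add]; congr 1; ring
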